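/- All graphs are finite and simple, $\rho(G)$ denotes the spectral radius of the adjacency matrix of $G$ (equivalently, its largest eigenvalue), and $\vee$ denotes the join of graphs. The gem is the graph $K_1\vee P_4$, and $G$ is gem-free if it has no subgraph (not necessarily induced) isomorphic to the gem. Let $S_{n,2}=K_2\vee (n-2)K_1$, and let $S_{n,2}^{-1}$ be the graph obtained from $S_{n,2}$ by deleting one edge between a vertex of degree $n-1$ and a vertex of degree $2$. Theorem. Let $G$ be a gem-free graph with $m\ge 92$ edges and no isolated vertices. (i) If $m$ is odd, then $$\rho(G)\le \frac{1+\sqrt{4m-3}}{2},$$ with equality if and only if $G\cong S_{\frac{m+3}{2},2}=K_2\vee \frac{m-1}{2}K_1$. (ii) If $m$ is even, then the polynomial $$x^4-mx^2-(m-2)x+\left(\frac m2-1\right)$$ has a largest real root $\rho^*(m)$, and $$\rho(G)\le \rho^*(m),$$ with equality if and only if $G\cong S^{-1}_{\frac{m+4}{2},2}$. -/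

import Mathlib

/-- The join `G ∨ H` of two (disjoint) graphs: their disjoint union together with all edges
between the vertices of `G` and the vertices of `H`. -/
def graphJoin {V W : Type*} (G : SimpleGraph V) (H : SimpleGraph W) : SimpleGraph (V ⊕ W) :=
  (G ⊕g H) ⊔ completeBipartiteGraph V W

/-- The gem `K₁ ∨ P₄`. -/
def gem : SimpleGraph (Fin 1 ⊕ Fin 4) :=
  graphJoin (⊤ : SimpleGraph (Fin 1)) (SimpleGraph.pathGraph 4)

/-- `S_{n,k} = K_k ∨ (n - k) K₁`, a graph on `n` vertices when `k ≤ n`. -/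
def graphS (n k : ℕ) : SimpleGraph (Fin k ⊕ Fin (n - k)) :=
  graphJoin (⊤ : SimpleGraph (Fin k)) (⊥ : SimpleGraph (Fin (n - k)))

/-- `S_{n,2}^{-t}`: the graph obtained from `S_{n,2}` by deleting the `t` edges between one of the
two vertices of degree `n - 1` and `t` of the vertices of degree `2` (for `t ≤ n - 2`). -/
def graphSMinus (n t : ℕ) : SimpleGraph (Fin 2 ⊕ Fin (n - 2)) :=
  (graphS n 2).deleteEdges
    {e | ∃ j : Fin (n - 2), (j : ℕ) < t ∧ e = s(Sum.inl 0, Sum.inr j)}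

/-- The spectral radius `ρ(G)` of a finite graph: the maximum modulus of the complex eigenvalues of
its adjacency matrix. (The spectrum of a matrix is finite, so `toReal` loses nothing.) -/
noncomputable def graphSpectralRadius {V : Type*} [Fintype V] [DecidableEq V]
    (G : SimpleGraph V) [DecidableRel G.Adj] : ℝ :=
  (spectralRadius ℂ (G.adjMatrix ℂ)).toReal

open Finset

/-! Take a nonnegative eigenvector x for ρ, scaled so that its largest entry is x_u = 1. Comparing
the eigenvalue equations at u and its neighbours with an edge count gives the identity
`IsPerronVector.sq_sub_eq`, which writes ρ² - ρ - m as a sum of nonpositive terms: the star weight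
of the link of u, the edges among vertices far from u, and the defects 1 - x_w over edges from near
to far vertices. Since G is gem-free, the link has no P₄, so its nontrivial components are stars and
triangles, and each star costs at least 1.

A graph reaching the claimed bound has ρ² - ρ > m - 3/2. This budget excludes triangles and a second
star (`exists_star`); the remaining slack, less than 1/2, excludes far vertices (`farSet_eq_empty`).
Hence G is K₂ ∨ (r + t)K₁ with t edges at one hub removed, and `exists_isBook` gives m = 2r + 1 + t
and (ρ² - ρ - (m - 1)) ρ(ρ + 1) = -t(ρ + r). Parity of m and the assumed lower bound on ρ force t =
0 or t = 1. Conversely, an explicit eigenvector shows that the extremal graphs reach the bound. -/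

theorem gem_free_forbids {V : Type*} {G : SimpleGraph V} (hG : gem.Free G) {u a b c d : V}
    (hua : G.Adj u a) (hub : G.Adj u b) (huc : G.Adj u c) (hud : G.Adj u d)
    (hab : G.Adj a b) (hbc : G.Adj b c) (hcd : G.Adj c d)
    (hac : a ≠ c) (had : a ≠ d) (hbd : b ≠ d) : False := by
  apply hG
  refine ⟨⟨⟨Sum.elim (fun _ => u) ![a, b, c, d], ?_⟩, ?_⟩⟩
  · rintro (i | i) (j | j) h
    · fin_cases i; fin_cases j; simp [gem, graphJoin] at h
    · fin_cases j <;> simpa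
    · fin_cases i <;> simp [*, G.adj_comm _ u]
    · simp only [gem, graphJoin, SimpleGraph.sup_adj, SimpleGraph.sum_adj,
        completeBipartiteGraph_adj] at h
      fin_cases i <;> fin_cases j <;>
        simp [SimpleGraph.pathGraph_adj] at h ⊢ <;> first | assumption | (symm; assumption)
  · have := hua.ne; have := hub.ne; have := huc.ne; have := hud.ne
    have := hab.ne; have := hbc.ne; have := hcd.ne
    rintro (i | i) (j | j) h
    · fin_cases i; fin_cases j; rfl
    · fin_cases j <;> simp_all
    · fin_cases i <;> simp_all [eq_comm]
    · fin_cases i <;> fin_cases j <;> simp_all [eq_comm]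

/-! ### Perron–Frobenius for the adjacency matrix -/

section
variable {V : Type*} [Fintype V] [DecidableEq V] (G : SimpleGraph V) [DecidableRel G.Adj]

theorem spectralRadius_adjMatrix_ne_top : spectralRadius ℂ (G.adjMatrix ℂ) ≠ ⊤ := by
  let _ : NormedRing (Matrix V V ℂ) := Matrix.linftyOpNormedRing
  let _ : NormedAlgebra ℂ (Matrix V V ℂ) := Matrix.linftyOpNormedAlgebra
  cases isEmpty_or_nonempty V
  · have : Subsingleton (Matrix V V ℂ) := inferInstance
    simp [spectralRadius, spectrum.of_subsingleton]
  · exact ne_top_of_le_ne_top ENNReal.coe_ne_top (spectrum.spectralRadius_le_nnnorm (𝕜 := ℂ) (G.adjMatrix ℂ))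

theorem norm_le_graphSpectralRadius {μ : ℂ} (h : μ ∈ spectrum ℂ (G.adjMatrix ℂ)) :
    ‖μ‖ ≤ graphSpectralRadius G := by
  have h1 : (‖μ‖₊ : ENNReal) ≤ spectralRadius ℂ (G.adjMatrix ℂ) :=
    le_iSup₂ (f := fun k (_ : k ∈ spectrum ℂ (G.adjMatrix ℂ)) => (‖k‖₊ : ENNReal)) μ h
  have := ENNReal.toReal_mono (spectralRadius_adjMatrix_ne_top G) h1
  simpa [graphSpectralRadius] using this

theorem exists_norm_eq_graphSpectralRadius [Nonempty V] :
    ∃ μ ∈ spectrum ℂ (G.adjMatrix ℂ), ‖μ‖ = graphSpectralRadius G := by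
  let _ : NormedRing (Matrix V V ℂ) := Matrix.linftyOpNormedRing
  let _ : NormedAlgebra ℂ (Matrix V V ℂ) := Matrix.linftyOpNormedAlgebra
  obtain ⟨μ, hμ, h⟩ := spectrum.exists_nnnorm_eq_spectralRadius (G.adjMatrix ℂ)
  refine ⟨μ, hμ, ?_⟩
  have := congrArg ENNReal.toReal h
  simpa [graphSpectralRadius] using this

theorem mem_spectrum_iff_exists_eigenvector (A : Matrix V V ℂ) (μ : ℂ) :
    μ ∈ spectrum ℂ A ↔ ∃ z : V → ℂ, z ≠ 0 ∧ A.mulVec z = μ • z := by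
  rw [← Matrix.spectrum_toLin', ← Module.End.hasEigenvalue_iff_mem_spectrum]
  constructor
  · intro h
    obtain ⟨z, hz⟩ := h.exists_hasEigenvector
    exact ⟨z, hz.2, by simpa using hz.apply_eq_smul⟩
  · rintro ⟨z, hz, h⟩
    exact Module.End.hasEigenvalue_of_hasEigenvector (x := z)
      ⟨Module.End.mem_eigenspace_iff.2 (by simpa using h), hz⟩

theorem le_graphSpectralRadius_of_eigenvector {r : ℝ} (x : V → ℝ) (hx : x ≠ 0)
    (h : ∀ v, ∑ w, (if G.Adj v w then x w else 0) = r * x v) : r ≤ graphSpectralRadius G := by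
  have hr : (r : ℂ) ∈ spectrum ℂ (G.adjMatrix ℂ) := by
    rw [mem_spectrum_iff_exists_eigenvector]
    refine ⟨fun v => x v, ?_, ?_⟩
    · intro h0
      exact hx (funext fun v => by simpa using congrFun h0 v)
    · funext v
      have := congrArg (fun y : ℝ => (y : ℂ)) (h v)
      simp only [Matrix.mulVec, dotProduct, SimpleGraph.adjMatrix_apply, ite_mul, one_mul, zero_mul,
        Pi.smul_apply, smul_eq_mul]
      push_cast at this
      rw [← this]
      exact sum_congr rfl fun w _ => by split_ifs <;> simp
  refine (le_abs_self r).trans ?_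
  simpa using norm_le_graphSpectralRadius G hr

-- Connectivity plays no role. For an eigenvector z of modulus ρ, the triangle inequality gives ρ|z|
-- ≤ A|z| entrywise, so the quadratic form of B = ρ - A is nonpositive at |z|. But B is positive
-- semidefinite, because no eigenvalue of A exceeds ρ; hence B|z| = 0.
open scoped ComplexOrder in
theorem exists_nonneg_eigenvector [Nonempty V] :
    ∃ x : V → ℝ, x ≠ 0 ∧ (∀ v, 0 ≤ x v) ∧
      ∀ v, ∑ w, (if G.Adj v w then x w else 0) = graphSpectralRadius G * x v := by
  obtain ⟨μ, hμ, hρ⟩ := exists_norm_eq_graphSpectralRadius G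
  obtain ⟨z, hz0, hz⟩ := (mem_spectrum_iff_exists_eigenvector _ _).1 hμ
  set ρ := graphSpectralRadius G
  have hherm : (G.adjMatrix ℂ).IsHermitian := by
    ext i j; simp [SimpleGraph.adjMatrix_apply, G.adj_comm i j]
  set B : Matrix V V ℂ := (ρ : ℂ) • (1 : Matrix V V ℂ) - G.adjMatrix ℂ with hB
  have hBh : B.IsHermitian := by
    apply Matrix.IsHermitian.sub _ hherm
    rw [Matrix.IsHermitian, Matrix.conjTranspose_smul]; simp
  have hBz : ∀ y : V → ℂ, B.mulVec y = (ρ : ℂ) • y - (G.adjMatrix ℂ).mulVec y := fun y => by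
    rw [hB, Matrix.sub_mulVec, Matrix.smul_mulVec, Matrix.one_mulVec]
  have hpsd : B.PosSemidef := by
    rw [hBh.posSemidef_iff_eigenvalues_nonneg]
    intro i
    have h1 := hBh.mulVec_eigenvectorBasis i
    set l := hBh.eigenvalues i
    have hmem : ((ρ - l : ℝ) : ℂ) ∈ spectrum ℂ (G.adjMatrix ℂ) := by
      rw [mem_spectrum_iff_exists_eigenvector]
      refine ⟨(hBh.eigenvectorBasis i).ofLp, ?_, ?_⟩
      · have := hBh.eigenvectorBasis.orthonormal.ne_zero i
        simpa using this
      · rw [hBz] at h1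
        funext v
        have := congrFun h1 v
        simp at this ⊢
        linear_combination -this
    have := norm_le_graphSpectralRadius G hmem
    rw [Complex.norm_real, Real.norm_eq_abs] at this
    have := (le_abs_self _).trans this
    simp only [Pi.zero_apply]; linarith
  let y : V → ℂ := fun v => (‖z v‖ : ℂ)
  have hsub : ∀ v, ρ * ‖z v‖ ≤ ∑ w, (if G.Adj v w then ‖z w‖ else 0) := by
    intro v
    have h1 := congrArg norm (congrFun hz v)
    simp only [Matrix.mulVec, dotProduct, SimpleGraph.adjMatrix_apply, ite_mul, one_mul, zero_mul,
        Pi.smul_apply, smul_eq_mul, norm_mul, hρ] at h1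
    rw [← h1]
    refine (norm_sum_le _ _).trans (sum_le_sum fun w _ => ?_)
    split_ifs <;> simp
  have hBy : ∀ v, B.mulVec y v = ((ρ * ‖z v‖ - ∑ w, (if G.Adj v w then ‖z w‖ else 0) : ℝ) : ℂ) := by
    intro v
    rw [hBz]
    simp only [Matrix.mulVec, dotProduct, SimpleGraph.adjMatrix_apply, ite_mul, one_mul, zero_mul,
        Pi.smul_apply, smul_eq_mul, Pi.sub_apply, y]
    push_cast
    congr 1
    exact sum_congr rfl fun w _ => by split_ifs <;> simp
  have hzero : B.mulVec y = 0 := by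
    rw [← hpsd.dotProduct_mulVec_zero_iff]
    apply le_antisymm _ (hpsd.dotProduct_mulVec_nonneg y)
    have : star y ⬝ᵥ B.mulVec y =
        ((∑ v, ‖z v‖ * (ρ * ‖z v‖ - ∑ w, (if G.Adj v w then ‖z w‖ else 0)) : ℝ) : ℂ) := by
      simp only [dotProduct, hBy]
      push_cast
      simp [y]
    rw [this]
    norm_cast
    refine sum_nonpos fun v _ => ?_
    exact mul_nonpos_of_nonneg_of_nonpos (norm_nonneg _) (by linarith [hsub v])
  refine ⟨fun v => ‖z v‖, ?_, fun v => norm_nonneg _, fun v => ?_⟩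
  · intro h0
    exact hz0 (funext fun v => by simpa using congrFun h0 v)
  · have := congrFun hzero v
    rw [hBy v, Pi.zero_apply, Complex.ofReal_eq_zero] at this
    linarith

theorem exists_normalized_eigenvector [Nonempty V] :
    ∃ (x : V → ℝ) (u : V), x u = 1 ∧ (∀ v, 0 ≤ x v) ∧ (∀ v, x v ≤ 1) ∧
      ∀ v, ∑ w, (if G.Adj v w then x w else 0) = graphSpectralRadius G * x v := by
  obtain ⟨x, hx0, hx, h⟩ := exists_nonneg_eigenvector G
  obtain ⟨u, hu⟩ := Finite.exists_max x
  have hpos : 0 < x u := by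
    obtain ⟨v, hv⟩ := Function.ne_iff.1 hx0
    exact (lt_of_le_of_ne (hx v) (Ne.symm hv)).trans_le (hu v)
  refine ⟨fun v => x v / x u, u, div_self hpos.ne', fun v => div_nonneg (hx v) hpos.le,
    fun v => (div_le_one hpos).2 (hu v), fun v => ?_⟩
  rw [← mul_div_assoc, ← h v, sum_div]
  refine sum_congr rfl fun w _ => ?_
  split_ifs <;> simp
end

/-! ### P₄-free graphs and the star weight -/

/-- `H` has no path on four vertices as a subgraph. -/
def PathFourFree {V : Type*} (H : SimpleGraph V) : Prop :=
  ∀ a b c d, H.Adj a b → H.Adj b c → H.Adj c d → a ≠ c → a ≠ d → b ≠ d → False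

/-- `{a, b, c}` spans a triangle that is a connected component of `H`. -/
structure IsTriangleComponent {V : Type*} (H : SimpleGraph V) (a b c : V) : Prop where
  ab : H.Adj a b
  ac : H.Adj a c
  bc : H.Adj b c
  eq_a : ∀ d, H.Adj a d → d = b ∨ d = c
  eq_b : ∀ d, H.Adj b d → d = a ∨ d = c
  eq_c : ∀ d, H.Adj c d → d = a ∨ d = b

/-- If a and b have further neighbours c and d, then c, a, b, d is a path unless c = d; any edge
leaving the resulting triangle would again create a P₄. -/
theorem PathFourFree.edge_cases {V : Type*} {H : SimpleGraph V} (hH : PathFourFree H) {a b : V}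
    (hab : H.Adj a b) :
    (∀ c, H.Adj a c → c = b) ∨ (∀ c, H.Adj b c → c = a) ∨ ∃ c, IsTriangleComponent H a b c := by
  by_contra! h
  obtain ⟨⟨c, hac, hcb⟩, ⟨d, hbd, hda⟩, h⟩ := h
  have hcd : c = d := by
    by_contra hcd
    exact hH c a b d hac.symm hab hbd hcb hcd hda.symm
  subst hcd
  refine h c ⟨hab, hac, hbd, fun e he => ?_, fun e he => ?_, fun e he => ?_⟩
  · by_contra! h
    exact hH e a b c he.symm hab hbd h.1 h.2 hac.ne
  · by_contra! h
    exact hH e b a c he.symm hab.symm hac h.1 h.2 hbd.ne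
  · by_contra! h
    exact hH e c a b he.symm hac.symm hab h.1 h.2 hbd.ne.symm

theorem PathFourFree.star_or_triangle {V : Type*} {H : SimpleGraph V} (hH : PathFourFree H)
    {a b : V} (hab : H.Adj a b) :
    (∃ c l, H.Adj c l ∧ (c = a ∨ c = b) ∧ ∀ d, H.Adj c d → ∀ e, H.Adj d e → e = c) ∨
      ∃ c, IsTriangleComponent H a b c := by
  have key : ∀ a b, H.Adj a b → (∀ c, H.Adj a c → c = b) →
      ∀ d, H.Adj b d → ∀ e, H.Adj d e → e = b := by
    intro a b hab ha d hd e he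
    by_contra hne
    have had : a ≠ d := fun h => hne (ha e (h ▸ he))
    have hae : a ≠ e := fun h => hd.ne (ha d (h ▸ he.symm)).symm
    exact hH a b d e hab hd he had hae (Ne.symm hne)
  rcases hH.edge_cases hab with h | h | h
  · exact Or.inl ⟨b, a, hab.symm, Or.inr rfl, key a b hab h⟩
  · exact Or.inl ⟨a, b, hab, Or.inl rfl, key b a hab.symm h⟩
  · exact Or.inr h

section
variable {V : Type*} [Fintype V] [DecidableEq V] {H : SimpleGraph V} [DecidableRel H.Adj]

omit [DecidableEq V] in
theorem degree_eq_one_of_forall {a b : V} (hab : H.Adj a b) (h : ∀ c, H.Adj a c → c = b) :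
    H.degree a = 1 := by
  rw [SimpleGraph.degree, card_eq_one]
  refine ⟨b, ?_⟩
  ext c
  simp only [SimpleGraph.mem_neighborFinset, mem_singleton]
  exact ⟨h c, fun e => e ▸ hab⟩

theorem degree_eq_two_of_forall {a b c : V} (hab : H.Adj a b) (hac : H.Adj a c) (hbc : b ≠ c)
    (h : ∀ d, H.Adj a d → d = b ∨ d = c) : H.degree a = 2 := by
  rw [SimpleGraph.degree, card_eq_two]
  refine ⟨b, c, hbc, ?_⟩
  ext d
  simp only [SimpleGraph.mem_neighborFinset, mem_insert, mem_singleton]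
  exact ⟨h d, by rintro (rfl | rfl) <;> assumption⟩

theorem PathFourFree.one_le_inv_degree_add (hH : PathFourFree H) {a b : V} (hab : H.Adj a b) :
    (1 : ℝ) ≤ (H.degree a : ℝ)⁻¹ + (H.degree b : ℝ)⁻¹ := by
  rcases hH.edge_cases hab with h | h | ⟨c, h⟩
  · rw [degree_eq_one_of_forall hab h]; simp
  · rw [degree_eq_one_of_forall hab.symm h]; simp
  · rw [degree_eq_two_of_forall h.ab h.ac h.bc.ne h.eq_a,
      degree_eq_two_of_forall h.ab.symm h.bc h.ac.ne h.eq_b]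
    norm_num

variable (H) in
/-- The sum of `(d(v) - 1) x(v) - d(v) / 2` over `v ∈ S`. -/
noncomputable def starWeight (x : V → ℝ) (S : Finset V) : ℝ :=
  ∑ v ∈ S, (((H.degree v : ℝ) - 1) * x v - (H.degree v : ℝ) / 2)

omit [DecidableEq V] in
theorem sum_ite_adj_const (S : Finset V) (hS : ∀ a ∈ S, ∀ b, H.Adj a b → b ∈ S) {a : V}
    (ha : a ∈ S) (t : ℝ) : ∑ b ∈ S, (if H.Adj a b then t else 0) = H.degree a * t := by
  rw [← sum_filter, sum_const, nsmul_eq_mul, SimpleGraph.degree]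
  congr 3
  ext b
  simp only [mem_filter, SimpleGraph.mem_neighborFinset]
  exact ⟨fun h => h.2, fun h => ⟨hS a ha b h, h⟩⟩

/-- Spread the weight of each non-isolated vertex evenly over its edges. As x ≤ 1, an edge ab
receives at most 1 - 1/d(a) - 1/d(b), which is nonpositive by `one_le_inv_degree_add`. An isolated
vertex weighs -x_v. -/
theorem PathFourFree.starWeight_nonpos (hH : PathFourFree H) {x : V → ℝ} (h0 : ∀ v, 0 ≤ x v)
    (h1 : ∀ v, x v ≤ 1) {S : Finset V} (hS : ∀ a ∈ S, ∀ b, H.Adj a b → b ∈ S) :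
    starWeight H x S ≤ 0 := by
  set g : V → ℝ := fun a => (1 - (H.degree a : ℝ)⁻¹) * x a - 1 / 2 with hg
  have hle : starWeight H x S ≤ ∑ a ∈ S, ∑ b ∈ S, (if H.Adj a b then g a else 0) := by
    refine sum_le_sum fun a ha => ?_
    rw [sum_ite_adj_const S hS ha]
    rcases Nat.eq_zero_or_pos (H.degree a) with h | h
    · simp [h, h0 a]
    · have : (H.degree a : ℝ) ≠ 0 := by positivity
      apply le_of_eq
      simp only [hg]
      field_simp
  have hsymm : ∑ a ∈ S, ∑ b ∈ S, (if H.Adj a b then g a else 0) =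
      ∑ a ∈ S, ∑ b ∈ S, (if H.Adj a b then g b else 0) := by
    rw [sum_comm]
    simp only [H.adj_comm]
  have hsum : ∑ a ∈ S, ∑ b ∈ S, (if H.Adj a b then g a else 0) +
      ∑ a ∈ S, ∑ b ∈ S, (if H.Adj a b then g b else 0) ≤ 0 := by
    rw [← sum_add_distrib]
    refine sum_nonpos fun a _ => ?_
    rw [← sum_add_distrib]
    refine sum_nonpos fun b _ => ?_
    split_ifs with hab
    · have hk := hH.one_le_inv_degree_add hab
      have hinv : ∀ v, (H.degree v : ℝ)⁻¹ ≤ 1 := fun v => Nat.cast_inv_le_one _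
      have h2 : ∀ v, (1 - (H.degree v : ℝ)⁻¹) * x v ≤ 1 - (H.degree v : ℝ)⁻¹ := fun v =>
        mul_le_of_le_one_right (by linarith [hinv v]) (h1 v)
      simp only [hg]
      linarith [h2 a, h2 b]
    · simp
  linarith

/-- The vertex `c` together with its neighbours. -/
abbrev starAt (H : SimpleGraph V) [DecidableRel H.Adj] (c : V) : Finset V :=
  insert c (H.neighborFinset c)

theorem starAt_closed {c : V} (hc : ∀ d, H.Adj c d → ∀ e, H.Adj d e → e = c) :
    ∀ a ∈ starAt H c, ∀ b, H.Adj a b → b ∈ starAt H c := by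
  intro a ha b hab
  simp only [mem_insert, SimpleGraph.mem_neighborFinset] at ha ⊢
  rcases ha with rfl | ha
  · exact Or.inr hab
  · exact Or.inl (hc a ha b hab)

omit [Fintype V] [DecidableRel H.Adj] in
theorem sdiff_closed {S T : Finset V} (hS : ∀ a ∈ S, ∀ b, H.Adj a b → b ∈ S)
    (hT : ∀ a ∈ T, ∀ b, H.Adj a b → b ∈ T) : ∀ a ∈ S \ T, ∀ b, H.Adj a b → b ∈ S \ T := by
  intro a ha b hab
  rw [mem_sdiff] at ha ⊢
  exact ⟨hS a ha.1 b hab, fun h => ha.2 (hT b h a hab.symm)⟩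

theorem starWeight_star (x : V → ℝ) {c : V} (hc : ∀ d, H.Adj c d → ∀ e, H.Adj d e → e = c) :
    starWeight H x (starAt H c) = ((H.degree c : ℝ) - 1) * x c - H.degree c := by
  rw [starWeight, sum_insert (by simp)]
  have : ∑ v ∈ H.neighborFinset c, (((H.degree v : ℝ) - 1) * x v - (H.degree v : ℝ) / 2) =
      ∑ v ∈ H.neighborFinset c, (-(1 / 2) : ℝ) := by
    refine sum_congr rfl fun v hv => ?_
    have hv := (H.mem_neighborFinset _ _).1 hv
    rw [degree_eq_one_of_forall hv.symm (hc v hv)]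
    norm_num
  rw [this, sum_const, nsmul_eq_mul, ← SimpleGraph.degree]
  ring

theorem starWeight_triangle (x : V → ℝ) {a b c : V} (h : IsTriangleComponent H a b c) :
    starWeight H x {a, b, c} = x a + x b + x c - 3 := by
  rw [starWeight, sum_insert (by simp [h.ab.ne, h.ac.ne]), sum_insert (by simp [h.bc.ne]),
    sum_singleton, degree_eq_two_of_forall h.ab h.ac h.bc.ne h.eq_a,
    degree_eq_two_of_forall h.ab.symm h.bc h.ac.ne h.eq_b,
    degree_eq_two_of_forall h.ac.symm h.bc.symm h.ab.ne h.eq_c]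
  push_cast
  ring

theorem starWeight_sdiff (x : V → ℝ) {S T : Finset V} (h : T ⊆ S) :
    starWeight H x S = starWeight H x (S \ T) + starWeight H x T :=
  (sum_sdiff h).symm

omit [Fintype V] [DecidableRel H.Adj] in
theorem IsTriangleComponent.closed {a b c : V} (h : IsTriangleComponent H a b c) :
    ∀ v ∈ ({a, b, c} : Finset V), ∀ w, H.Adj v w → w ∈ ({a, b, c} : Finset V) := by
  intro v hv w hvw
  simp only [mem_insert, mem_singleton] at hv ⊢
  rcases hv with rfl | rfl | rfl
  · exact Or.inr (h.eq_a w hvw)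
  · have := h.eq_b w hvw; tauto
  · have := h.eq_c w hvw; tauto

/-- Every component star contributes at most `-1` to the weight. -/
theorem starWeight_star_le (x : V → ℝ) (h1 : ∀ v, x v ≤ 1) {c l : V} (hl : H.Adj c l)
    (hc : ∀ d, H.Adj c d → ∀ e, H.Adj d e → e = c) : starWeight H x (starAt H c) ≤ -1 := by
  rw [starWeight_star x hc]
  have : (1 : ℝ) ≤ H.degree c := by
    exact_mod_cast (H.degree_pos_iff_exists_adj c).2 ⟨l, hl⟩
  nlinarith [h1 c]

/-- A closed set of weight more than `-3/2` without triangles is edgeless outside of one star. -/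
theorem PathFourFree.edgeless_outside_star (hH : PathFourFree H) {x : V → ℝ} (h0 : ∀ v, 0 ≤ x v)
    (h1 : ∀ v, x v ≤ 1) {S : Finset V} (hS : ∀ a ∈ S, ∀ b, H.Adj a b → b ∈ S)
    (htri : ∀ a b c, ¬ IsTriangleComponent H a b c) (hw : -(3 / 2) < starWeight H x S)
    {c l : V} (hcS : c ∈ S) (hl : H.Adj c l) (hc : ∀ d, H.Adj c d → ∀ e, H.Adj d e → e = c)
    {a b : V} (ha : a ∈ S \ starAt H c) : ¬ H.Adj a b := by
  intro hab
  have hcl := sdiff_closed hS (starAt_closed hc)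
  have hsub : starAt H c ⊆ S := by
    intro v hv
    simp only [mem_insert, SimpleGraph.mem_neighborFinset] at hv
    rcases hv with rfl | hv
    · exact hcS
    · exact hS c hcS v hv
  rcases hH.star_or_triangle hab with ⟨c', l', hl', hc'ab, hc'⟩ | ⟨c', h⟩
  · have hc'S : c' ∈ S \ starAt H c := by
      rcases hc'ab with rfl | rfl
      · exact ha
      · exact hcl a ha _ hab
    have hsub' : starAt H c' ⊆ S \ starAt H c := by
      intro v hv
      simp only [mem_insert, SimpleGraph.mem_neighborFinset] at hv
      rcases hv with rfl | hv
      · exact hc'S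
      · exact hcl c' hc'S v hv
    have e1 := starWeight_sdiff (H := H) x hsub
    have e2 := starWeight_sdiff (H := H) x hsub'
    -- Two disjoint stars would weigh at most -2, and the rest at most 0, below the allowed -3/2.
    have e3 := hH.starWeight_nonpos h0 h1 (sdiff_closed hcl (starAt_closed hc'))
    have e4 := starWeight_star_le x h1 hl hc
    have e5 := starWeight_star_le x h1 hl' hc'
    linarith
  · exact htri _ _ _ h
end

/-! ### The link of a vertex and the identity for ρ² - ρ - m -/

/-- The graph induced by `G` on the neighbours of `u`, on the original vertex type. -/
def linkGraph {V : Type*} (G : SimpleGraph V) (u : V) : SimpleGraph V where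
  Adj a b := G.Adj u a ∧ G.Adj u b ∧ G.Adj a b
  symm := ⟨fun _ _ h => ⟨h.2.1, h.1, h.2.2.symm⟩⟩
  loopless := ⟨fun _ h => h.2.2.ne rfl⟩

instance {V : Type*} (G : SimpleGraph V) [DecidableRel G.Adj] (u : V) :
    DecidableRel (linkGraph G u).Adj :=
  fun a b => inferInstanceAs (Decidable (G.Adj u a ∧ G.Adj u b ∧ G.Adj a b))

theorem linkGraph_pathFourFree {V : Type*} {G : SimpleGraph V} (hG : gem.Free G) (u : V) :
    PathFourFree (linkGraph G u) := fun _ _ _ _ hab hbc hcd hac had hbd =>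
  gem_free_forbids hG hab.1 hab.2.1 hcd.1 hcd.2.1 hab.2.2 hbc.2.2 hcd.2.2 hac had hbd

section
variable {V : Type*} [Fintype V] [DecidableEq V] (G : SimpleGraph V) [DecidableRel G.Adj]

/-- The vertices at distance at least two from `u`. -/
def farSet (u : V) : Finset V := univ.filter fun v => v ≠ u ∧ ¬ G.Adj u v

/-- The number of edges between `w` and the neighbours of `u`. -/
def nearDegree (u w : V) : ℝ := ∑ v ∈ G.neighborFinset u, if G.Adj v w then 1 else 0

/-- The number of edges between `v` and the vertices at distance at least two from `u`. -/
def farDegree (u v : V) : ℝ := ∑ w ∈ farSet G u, if G.Adj v w then 1 else 0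

variable {G}

theorem mem_farSet {u v : V} : v ∈ farSet G u ↔ v ≠ u ∧ ¬ G.Adj u v := by simp [farSet]

omit [DecidableEq V] in
theorem nearDegree_nonneg (u w : V) : 0 ≤ nearDegree G u w :=
  sum_nonneg fun _ _ => by split_ifs <;> simp

theorem farDegree_nonneg (u w : V) : 0 ≤ farDegree G u w :=
  sum_nonneg fun _ _ => by split_ifs <;> simp

theorem sum_univ_eq_near_far (u : V) (f : V → ℝ) :
    ∑ v, f v = f u + ∑ v ∈ G.neighborFinset u, f v + ∑ v ∈ farSet G u, f v := by
  rw [← sum_erase_add univ f (mem_univ u),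
    ← sum_filter_add_sum_filter_not (univ.erase u) (fun v => G.Adj u v)]
  have h1 : (univ.erase u).filter (fun v => G.Adj u v) = G.neighborFinset u := by
    ext v
    simp only [mem_filter, mem_erase, mem_univ, and_true, SimpleGraph.mem_neighborFinset]
    exact ⟨fun h => h.2, fun h => ⟨h.ne.symm, h⟩⟩
  have h2 : (univ.erase u).filter (fun v => ¬ G.Adj u v) = farSet G u := by
    ext v
    simp [mem_farSet]
  rw [h1, h2]
  ring

theorem row_sum_near {u v : V} (hv : G.Adj u v) (f : V → ℝ) :
    ∑ w, (if G.Adj v w then f w else 0) =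
      f u + ∑ w ∈ G.neighborFinset u, (if (linkGraph G u).Adj v w then f w else 0) +
        ∑ w ∈ farSet G u, (if G.Adj v w then f w else 0) := by
  rw [sum_univ_eq_near_far (G := G) u, if_pos hv.symm]
  congr 2
  refine sum_congr rfl fun w hw => ?_
  rw [SimpleGraph.mem_neighborFinset] at hw
  have : (linkGraph G u).Adj v w ↔ G.Adj v w := ⟨fun h => h.2.2, fun h => ⟨hv, hw, h⟩⟩
  simp [this]

theorem row_sum_far {u w : V} (hw : w ∈ farSet G u) (f : V → ℝ) :
    ∑ v, (if G.Adj w v then f v else 0) =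
      ∑ v ∈ G.neighborFinset u, (if G.Adj w v then f v else 0) +
        ∑ v ∈ farSet G u, (if G.Adj w v then f v else 0) := by
  rw [sum_univ_eq_near_far (G := G) u, if_neg fun h => (mem_farSet.1 hw).2 h.symm, zero_add]

omit [DecidableEq V] in
theorem degree_eq_sum_ite (v : V) : (G.degree v : ℝ) = ∑ w, if G.Adj v w then 1 else 0 := by
  rw [sum_boole, SimpleGraph.degree, SimpleGraph.neighborFinset_eq_filter]

omit [DecidableEq V] in
theorem linkGraph_closed (u : V) : ∀ a ∈ G.neighborFinset u, ∀ b, (linkGraph G u).Adj a b →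
    b ∈ G.neighborFinset u := fun _ _ _ h => (G.mem_neighborFinset _ _).2 h.2.1

theorem degree_near {u v : V} (hv : G.Adj u v) :
    (G.degree v : ℝ) = 1 + (linkGraph G u).degree v + farDegree G u v := by
  rw [degree_eq_sum_ite, row_sum_near hv, sum_ite_adj_const _ (linkGraph_closed u) (by simpa),
    mul_one]
  rfl

theorem degree_far {u w : V} (hw : w ∈ farSet G u) :
    (G.degree w : ℝ) = nearDegree G u w + farDegree G u w := by
  rw [degree_eq_sum_ite, row_sum_far hw]
  simp only [nearDegree, farDegree, G.adj_comm w]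

theorem sum_farDegree (u : V) : ∑ v ∈ G.neighborFinset u, farDegree G u v =
    ∑ w ∈ farSet G u, nearDegree G u w := sum_comm

theorem card_edges_eq (u : V) : (#G.edgeFinset : ℝ) = G.degree u +
    (∑ v ∈ G.neighborFinset u, ((linkGraph G u).degree v : ℝ)) / 2 +
    ∑ w ∈ farSet G u, nearDegree G u w + (∑ w ∈ farSet G u, farDegree G u w) / 2 := by
  have h : (∑ v, (G.degree v : ℝ)) = 2 * #G.edgeFinset := by
    exact_mod_cast G.sum_degrees_eq_twice_card_edges
  rw [sum_univ_eq_near_far (G := G) u, sum_congr rfl fun v hv => degree_near (by simpa using hv),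
    sum_congr rfl fun w hw => degree_far hw, sum_add_distrib, sum_add_distrib, sum_add_distrib,
    sum_farDegree, sum_const, nsmul_eq_mul, mul_one, ← SimpleGraph.degree] at h
  linarith

variable (G) in
/-- A nonnegative eigenvector of `G` for `ρ` with its largest entry `1` at `u`. -/
structure IsPerronVector (ρ : ℝ) (x : V → ℝ) (u : V) : Prop where
  one : x u = 1
  nonneg : ∀ v, 0 ≤ x v
  le_one : ∀ v, x v ≤ 1
  eig : ∀ v, ∑ w, (if G.Adj v w then x w else 0) = ρ * x v

namespace IsPerronVector
variable {ρ : ℝ} {x : V → ℝ} {u : V}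

omit [DecidableEq V] in
theorem sum_near (h : IsPerronVector G ρ x u) : ∑ v ∈ G.neighborFinset u, x v = ρ := by
  have := h.eig u
  rwa [h.one, mul_one, ← sum_filter, ← SimpleGraph.neighborFinset_eq_filter] at this

omit [DecidableEq V] in
theorem mul_le_degree (h : IsPerronVector G ρ x u) (v : V) : ρ * x v ≤ G.degree v := by
  rw [← h.eig v, degree_eq_sum_ite]
  refine sum_le_sum fun w _ => ?_
  split_ifs
  · exact h.le_one w
  · rfl

/-- This evaluates (A²x)_u, sorting the walks of length two from u by whether they end at u, in its
neighbourhood, or far away. -/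
theorem sum_near_mul (h : IsPerronVector G ρ x u) : ρ ^ 2 = G.degree u +
    ∑ v ∈ G.neighborFinset u, (linkGraph G u).degree v * x v +
    ∑ w ∈ farSet G u, nearDegree G u w * x w := by
  have h1 : ρ ^ 2 = ∑ v ∈ G.neighborFinset u, ρ * x v := by rw [← mul_sum, h.sum_near, sq]
  rw [h1, sum_congr rfl fun v hv => by rw [← h.eig v, row_sum_near (by simpa using hv), h.one],
    sum_add_distrib, sum_add_distrib, sum_const, nsmul_eq_mul, mul_one, ← SimpleGraph.degree]
  congr 1
  · congr 1
    rw [sum_comm]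
    refine sum_congr rfl fun v hv => ?_
    simp only [(linkGraph G u).adj_comm _ v]
    exact sum_ite_adj_const _ (linkGraph_closed u) hv _
  · rw [sum_comm]
    refine sum_congr rfl fun w _ => ?_
    rw [nearDegree, sum_mul]
    exact sum_congr rfl fun v _ => by split_ifs <;> simp

/-- Subtract the edge count and ρ = Σ x_v over the neighbours of u from `sum_near_mul`. For gem-free
G every contribution on the right is nonpositive, so a lower bound on the left limits each of them.
-/
theorem sq_sub_eq (h : IsPerronVector G ρ x u) : ρ ^ 2 - ρ - #G.edgeFinset =
    starWeight (linkGraph G u) x (G.neighborFinset u) - (∑ w ∈ farSet G u, farDegree G u w) / 2 -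
      ∑ w ∈ farSet G u, nearDegree G u w * (1 - x w) := by
  rw [card_edges_eq u, h.sum_near_mul, starWeight]
  simp only [sub_mul, mul_sub, sum_sub_distrib, one_mul, mul_one, ← sum_div, h.sum_near]
  ring

end IsPerronVector
end

/-! ### Structure of a graph with ρ² - ρ > m - 3/2 -/

/-- The gem has hub a and path w, b, c, u. -/
theorem false_of_far_adj_two {V : Type*} {G : SimpleGraph V} (hG : gem.Free G) {u a b c w : V}
    (hab : (linkGraph G u).Adj a b) (hac : (linkGraph G u).Adj a c) (hbc : (linkGraph G u).Adj b c)
    (hwu : w ≠ u) (huw : ¬ G.Adj u w) (ha : G.Adj a w) (hb : G.Adj b w) : False :=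
  gem_free_forbids hG ha hab.2.2 hac.2.2 hab.1.symm hb.symm hbc.2.2 hbc.2.1.symm
    (fun h => huw (h ▸ hbc.2.1)) hwu hab.2.1.ne.symm

section
variable {V : Type*} [Fintype V] [DecidableEq V] {G : SimpleGraph V} [DecidableRel G.Adj]

omit [DecidableEq V] in
theorem starWeight_of_edgeless {H : SimpleGraph V} [DecidableRel H.Adj] (x : V → ℝ) {S : Finset V}
    (hS : ∀ a ∈ S, ∀ b, ¬ H.Adj a b) : starWeight H x S = -∑ v ∈ S, x v := by
  rw [starWeight, ← sum_neg_distrib]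
  refine sum_congr rfl fun v hv => ?_
  have : H.degree v = 0 := by
    by_contra h
    obtain ⟨w, hw⟩ := (H.degree_pos_iff_exists_adj v).1 (Nat.pos_of_ne_zero h)
    exact hS v hv w hw
  simp [this]

namespace IsPerronVector
variable {ρ : ℝ} {x : V → ℝ} {u : V}

theorem triangle_row (h : IsPerronVector G ρ x u) {a b c : V} (hua : G.Adj u a) (hbc : b ≠ c)
    (hab : (linkGraph G u).Adj a b) (hac : (linkGraph G u).Adj a c)
    (ha : ∀ d, (linkGraph G u).Adj a d → d = b ∨ d = c) :
    ρ * x a = 1 + (x b + x c) + ∑ w ∈ farSet G u, (if G.Adj a w then x w else 0) := by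
  rw [← h.eig a, row_sum_near hua, h.one, ← sum_filter, ← sum_pair (f := x) hbc]
  congr 3
  ext d
  simp only [mem_filter, SimpleGraph.mem_neighborFinset, mem_insert, mem_singleton]
  constructor
  · exact fun hd => ha d hd.2
  · rintro (rfl | rfl)
    · exact ⟨hab.2.1, hab⟩
    · exact ⟨hac.2.1, hac⟩

omit [DecidableEq V] in
theorem loss_nonneg (h : IsPerronVector G ρ x u) (w : V) : 0 ≤ nearDegree G u w * (1 - x w) :=
  mul_nonneg (nearDegree_nonneg u w) (by linarith [h.le_one w])

/-- The triangle weighs s - 3 with s = x_a + x_b + x_c, so the budget forces s ≥ 3/2. Adding its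
three rows, its far neighbours carry total weight (ρ - 2)s - 3. Each far vertex meets the triangle
at most once and satisfies ρ x_w ≤ d(w), so the far degrees sum to at least ρ(3ρ/2 - 6). Together
with the d(u) ≥ ρ edges at u this is more than m allows. -/
theorem link_no_triangle (h : IsPerronVector G ρ x u) (hG : gem.Free G) (hρ : 10 ≤ ρ)
    (hm : (#G.edgeFinset : ℝ) - 3 / 2 < ρ ^ 2 - ρ) (a b c : V) :
    ¬ IsTriangleComponent (linkGraph G u) a b c := by
  intro ht
  have hm' := h.sq_sub_eq
  have hcard := card_edges_eq (G := G) u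
  have hsub : ({a, b, c} : Finset V) ⊆ G.neighborFinset u := by
    intro v hv
    simp only [mem_insert, mem_singleton] at hv
    rw [SimpleGraph.mem_neighborFinset]
    rcases hv with rfl | rfl | rfl
    exacts [ht.ab.1, ht.ab.2.1, ht.ac.2.1]
  rw [starWeight_sdiff _ hsub, starWeight_triangle x ht] at hm'
  have hrest := (linkGraph_pathFourFree hG u).starWeight_nonpos h.nonneg h.le_one
    (sdiff_closed (linkGraph_closed u) ht.closed)
  have hloss : 0 ≤ ∑ w ∈ farSet G u, nearDegree G u w * (1 - x w) :=
    sum_nonneg fun w _ => h.loss_nonneg w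
  have hD : 0 ≤ ∑ w ∈ farSet G u, farDegree G u w := sum_nonneg fun w _ => farDegree_nonneg u w
  have hlink : 0 ≤ ∑ v ∈ G.neighborFinset u, ((linkGraph G u).degree v : ℝ) :=
    sum_nonneg fun _ _ => Nat.cast_nonneg _
  have hu := h.mul_le_degree u
  rw [h.one, mul_one] at hu
  have ra := h.triangle_row ht.ab.1 ht.bc.ne ht.ab ht.ac ht.eq_a
  have rb := h.triangle_row ht.ab.2.1 ht.ac.ne ht.ab.symm ht.bc ht.eq_b
  have rc := h.triangle_row ht.ac.2.1 ht.ab.ne ht.ac.symm ht.bc.symm ht.eq_c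
  have hfar : ρ * (∑ w ∈ farSet G u, (if G.Adj a w then x w else 0) +
      ∑ w ∈ farSet G u, (if G.Adj b w then x w else 0) +
      ∑ w ∈ farSet G u, (if G.Adj c w then x w else 0)) ≤
      ∑ w ∈ farSet G u, nearDegree G u w + ∑ w ∈ farSet G u, farDegree G u w := by
    rw [← sum_add_distrib, ← sum_add_distrib, ← sum_add_distrib, mul_sum]
    refine sum_le_sum fun w hw => ?_
    rw [← degree_far hw]
    refine le_trans ?_ (h.mul_le_degree w)
    refine mul_le_mul_of_nonneg_left ?_ (by linarith)
    obtain ⟨hwu, huw⟩ := mem_farSet.1 hw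
    have n1 := false_of_far_adj_two hG ht.ab ht.ac ht.bc hwu huw
    have n2 := false_of_far_adj_two hG ht.ac ht.ab ht.bc.symm hwu huw
    have n3 := false_of_far_adj_two hG ht.bc ht.ab.symm ht.ac.symm hwu huw
    have := h.nonneg w
    split_ifs <;> first | linarith | exact (n1 ‹_› ‹_›).elim | exact (n2 ‹_› ‹_›).elim |
      exact (n3 ‹_› ‹_›).elim
  have hs : 3 / 2 ≤ x a + x b + x c := by linarith
  have hla := h.le_one a
  have hlb := h.le_one b
  have hlc := h.le_one c
  have hfar' : ρ * ((ρ - 2) * (x a + x b + x c) - 3) ≤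
      ∑ w ∈ farSet G u, nearDegree G u w + ∑ w ∈ farSet G u, farDegree G u w := by
    refine le_trans (le_of_eq ?_) hfar
    congr 1
    linarith
  have hfar'' : ρ * ((ρ - 2) * (3 / 2) - 3) ≤ ρ * ((ρ - 2) * (x a + x b + x c) - 3) := by
    refine mul_le_mul_of_nonneg_left ?_ (by linarith)
    nlinarith
  nlinarith

/-- The link of `u` consists of one star, centred at `c`, and isolated vertices. -/
theorem exists_star (h : IsPerronVector G ρ x u) (hG : gem.Free G) (hρ : 10 ≤ ρ)
    (hm : (#G.edgeFinset : ℝ) - 3 / 2 < ρ ^ 2 - ρ) :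
    ∃ c, G.Adj u c ∧ 1 ≤ (linkGraph G u).degree c ∧
      (∀ d, (linkGraph G u).Adj c d → ∀ e, (linkGraph G u).Adj d e → e = c) ∧
      ∀ a ∈ G.neighborFinset u \ starAt (linkGraph G u) c, ∀ b, ¬ (linkGraph G u).Adj a b := by
  have hP := linkGraph_pathFourFree hG u
  have hw : -(3 / 2) < starWeight (linkGraph G u) x (G.neighborFinset u) := by
    have hm' := h.sq_sub_eq
    have hloss : 0 ≤ ∑ w ∈ farSet G u, nearDegree G u w * (1 - x w) :=
      sum_nonneg fun w _ => h.loss_nonneg w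
    have hD : 0 ≤ ∑ w ∈ farSet G u, farDegree G u w := sum_nonneg fun w _ => farDegree_nonneg u w
    linarith
  -- An edgeless link would weigh -ρ ≤ -10.
  have hne : ∃ a b, (linkGraph G u).Adj a b := by
    by_contra! hne
    rw [starWeight_of_edgeless x fun a _ b => hne a b, h.sum_near] at hw
    linarith
  have hnt := h.link_no_triangle hG hρ hm
  obtain ⟨a, b, hab⟩ := hne
  rcases hP.star_or_triangle hab with ⟨c, l, hl, -, hc⟩ | ⟨c, ht⟩
  · refine ⟨c, hl.1, ((linkGraph G u).degree_pos_iff_exists_adj c).2 ⟨l, hl⟩, hc, ?_⟩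
    intro a ha b
    exact hP.edgeless_outside_star h.nonneg h.le_one (linkGraph_closed u) hnt hw (by simpa using hl.1) hl
      hc ha
  · exact (hnt _ _ _ ht).elim

theorem starAt_subset {c : V} (hc : G.Adj u c) :
    starAt (linkGraph G u) c ⊆ G.neighborFinset u := by
  intro v hv
  simp only [mem_insert, SimpleGraph.mem_neighborFinset] at hv ⊢
  rcases hv with rfl | hv
  exacts [hc, hv.2.1]

theorem sum_near_eq_star {c : V} (hc : G.Adj u c) (f : V → ℝ) :
    ∑ v ∈ G.neighborFinset u, f v = f c + ∑ v ∈ (linkGraph G u).neighborFinset c, f v +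
      ∑ v ∈ G.neighborFinset u \ starAt (linkGraph G u) c, f v := by
  rw [← sum_sdiff (starAt_subset hc), sum_insert (by simp)]
  ring

theorem sq_sub_eq_star (h : IsPerronVector G ρ x u) {c : V} (huc : G.Adj u c)
    (hc : ∀ d, (linkGraph G u).Adj c d → ∀ e, (linkGraph G u).Adj d e → e = c)
    (hI : ∀ a ∈ G.neighborFinset u \ starAt (linkGraph G u) c, ∀ b, ¬ (linkGraph G u).Adj a b) :
    ρ ^ 2 - ρ - #G.edgeFinset = -1 - (((linkGraph G u).degree c : ℝ) - 1) * (1 - x c) -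
      ∑ v ∈ G.neighborFinset u \ starAt (linkGraph G u) c, x v -
      (∑ w ∈ farSet G u, farDegree G u w) / 2 -
      ∑ w ∈ farSet G u, nearDegree G u w * (1 - x w) := by
  rw [h.sq_sub_eq, starWeight_sdiff x (starAt_subset huc), starWeight_star x hc,
    starWeight_of_edgeless x hI]
  ring

/-- The star already uses 1 of the budget 3/2, so all other losses total less than 1/2. A far vertex
w then has no far neighbours, and bootstrapping d(w)(1 - x_w) < 1/2 against ρ x_w ≤ d(w) gives x_w >
9/10. The neighbours of w thus carry weight at least 9, which is refuted according to whether w is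
adjacent to c. -/
theorem farSet_eq_empty (h : IsPerronVector G ρ x u) (hG : gem.Free G) (hρ : 10 ≤ ρ)
    (hm : (#G.edgeFinset : ℝ) - 3 / 2 < ρ ^ 2 - ρ) (hiso : ∀ v, ∃ w, G.Adj v w)
    {c : V} (huc : G.Adj u c) (hdc : 1 ≤ (linkGraph G u).degree c)
    (hc : ∀ d, (linkGraph G u).Adj c d → ∀ e, (linkGraph G u).Adj d e → e = c)
    (hI : ∀ a ∈ G.neighborFinset u \ starAt (linkGraph G u) c, ∀ b, ¬ (linkGraph G u).Adj a b) :
    farSet G u = ∅ := by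
  by_contra hne
  obtain ⟨w, hw⟩ := nonempty_iff_ne_empty.2 hne
  obtain ⟨hwu, huw⟩ := mem_farSet.1 hw
  have hm' := h.sq_sub_eq_star huc hc hI
  have hloss : nearDegree G u w * (1 - x w) ≤ ∑ w ∈ farSet G u, nearDegree G u w * (1 - x w) :=
    single_le_sum (f := fun w => nearDegree G u w * (1 - x w)) (fun w _ => h.loss_nonneg w) hw
  have hD : farDegree G u w ≤ ∑ w ∈ farSet G u, farDegree G u w :=
    single_le_sum (f := farDegree G u) (fun w _ => farDegree_nonneg u w) hw
  have hD0 := farDegree_nonneg (G := G) u w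
  have hl0 := h.loss_nonneg w
  have hI0 : 0 ≤ ∑ v ∈ G.neighborFinset u \ starAt (linkGraph G u) c, x v :=
    sum_nonneg fun v _ => h.nonneg v
  have hr : (1 : ℝ) ≤ (linkGraph G u).degree c := by exact_mod_cast hdc
  have hxc := h.le_one c
  have hc0 : 0 ≤ (((linkGraph G u).degree c : ℝ) - 1) * (1 - x c) :=
    mul_nonneg (by linarith) (by linarith)
  have hnofar : ∀ v ∈ farSet G u, ¬ G.Adj w v := by
    intro v hv hwv
    have : 1 ≤ farDegree G u w := by
      have := single_le_sum (f := fun v => if G.Adj w v then (1 : ℝ) else 0)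
        (fun v _ => by split_ifs <;> simp) hv
      rwa [if_pos hwv] at this
    linarith
  have hrow : ∑ v ∈ G.neighborFinset u, (if G.Adj w v then x v else 0) = ρ * x w := by
    rw [← h.eig w, row_sum_far hw, left_eq_add]
    exact sum_eq_zero fun v hv => if_neg (hnofar v hv)
  have hfd : farDegree G u w = 0 :=
    sum_eq_zero fun v hv => if_neg (hnofar v hv)
  have hdeg := degree_far hw
  rw [hfd, add_zero] at hdeg
  have hd1 : (1 : ℝ) ≤ G.degree w := by
    exact_mod_cast (G.degree_pos_iff_exists_adj w).2 (hiso w)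
  have hdx := h.mul_le_degree w
  rw [hdeg] at hd1 hdx
  have hxw1 := h.le_one w
  have hlt : nearDegree G u w * (1 - x w) < 1 / 2 := by linarith
  have hx1 : 1 / 2 < x w := by nlinarith
  have hd5 : 5 ≤ nearDegree G u w := by nlinarith
  have hx2 : 9 / 10 < x w := by nlinarith
  have h9 : 9 ≤ ρ * x w := by nlinarith
  have hsplit := sum_near_eq_star huc (fun v => if G.Adj w v then x v else 0)
  rw [hrow] at hsplit
  have hIle : ∑ v ∈ G.neighborFinset u \ starAt (linkGraph G u) c, (if G.Adj w v then x v else 0)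
      ≤ ∑ v ∈ G.neighborFinset u \ starAt (linkGraph G u) c, x v :=
    sum_le_sum fun v _ => by split_ifs <;> simp [h.nonneg v]
  by_cases hwc : G.Adj w c
  · have hL : ∑ v ∈ (linkGraph G u).neighborFinset c, (if G.Adj w v then x v else 0) ≤ 1 := by
      rw [← sum_filter]
      refine (sum_le_card_nsmul _ _ 1 fun v _ => h.le_one v).trans ?_
      rw [nsmul_eq_mul, mul_one]
      suffices #{v ∈ (linkGraph G u).neighborFinset c | G.Adj w v} ≤ 1 by exact_mod_cast this
      rw [card_le_one]
      intro p hp q hq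
      simp only [mem_filter, SimpleGraph.mem_neighborFinset] at hp hq
      by_contra hpq
      -- Two leaves p, q adjacent to w give the gem with hub c and path p, w, q, u.
      exact gem_free_forbids hG hp.1.2.2 hwc.symm hq.1.2.2 huc.symm hp.2.symm hq.2 hq.1.2.1.symm
        hpq hp.1.2.1.ne.symm hwu
    simp only [if_pos hwc] at hsplit
    linarith
  · simp only [if_neg hwc] at hsplit
    have hL : ∑ v ∈ (linkGraph G u).neighborFinset c, (if G.Adj w v then x v else 0) ≤
        (linkGraph G u).degree c := by
      refine (sum_le_card_nsmul _ _ 1 fun v _ => ?_).trans (by simp)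
      split_ifs
      · exact h.le_one v
      · exact zero_le_one
    -- The star needs more than 8 leaves to feed w, so (r - 1)(1 - x_c) < 1/2 pins x_c near 1.
    have hxc9 : 9 / 10 < x c := by nlinarith
    have hgap : x c ≤ ρ - ρ * x w := by
      have hs := sum_near_eq_star huc x
      rw [h.sum_near] at hs
      have hL' : ∑ v ∈ (linkGraph G u).neighborFinset c, (if G.Adj w v then x v else 0) ≤
          ∑ v ∈ (linkGraph G u).neighborFinset c, x v :=
        sum_le_sum fun v _ => by split_ifs <;> simp [h.nonneg v]
      linarith
    -- As w misses c, d(w)(1 - x_w) ≥ ρ x_w(1 - x_w) ≥ x_w x_c > 1/2.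
    have : x w * x c ≤ x w * (ρ - ρ * x w) := mul_le_mul_of_nonneg_left hgap (by linarith)
    nlinarith

end IsPerronVector

/-! ### Books: K₂ ∨ kK₁ with edges removed at one hub -/

variable (G) in
/-- `G` is a copy of `K₂ ∨ k K₁` with hubs `u`, `c` after removal of the edges from `c` to `I`. -/
structure IsBook (u c : V) (I : Finset V) : Prop where
  adj_hub : ∀ v, v ≠ u → G.Adj u v
  ne : u ≠ c
  notMem : u ∉ I ∧ c ∉ I
  adj_center : ∀ v, v ≠ u → v ≠ c → (G.Adj c v ↔ v ∉ I)
  indep : ∀ v w, v ≠ u → v ≠ c → w ≠ u → w ≠ c → ¬ G.Adj v w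

theorem IsPerronVector.exists_isBook {ρ : ℝ} {x : V → ℝ} {u : V} (h : IsPerronVector G ρ x u)
    (hG : gem.Free G) (hρ : 10 ≤ ρ) (hm : (#G.edgeFinset : ℝ) - 3 / 2 < ρ ^ 2 - ρ)
    (hiso : ∀ v, ∃ w, G.Adj v w) :
    ∃ (c : V) (I : Finset V) (r : ℕ), IsBook G u c I ∧ 1 ≤ r ∧ Fintype.card V = r + #I + 2 ∧
      #G.edgeFinset = 2 * r + 1 + #I ∧
      (ρ ^ 2 - ρ - (#G.edgeFinset - 1)) * (ρ * (ρ + 1)) = -(#I * (ρ + r)) := by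
  obtain ⟨c, huc, hdc, hc, hI⟩ := h.exists_star hG hρ hm
  have hfar := h.farSet_eq_empty hG hρ hm hiso huc hdc hc hI
  set I := G.neighborFinset u \ starAt (linkGraph G u) c with hIdef
  have hall : ∀ v, v ≠ u → G.Adj u v := by
    intro v hv
    by_contra hn
    have : v ∈ farSet G u := mem_farSet.2 ⟨hv, hn⟩
    simp [hfar] at this
  have hlink : ∀ v w, v ≠ u → w ≠ u → (G.Adj v w ↔ (linkGraph G u).Adj v w) := fun v w hv hw =>
    ⟨fun h => ⟨hall v hv, hall w hw, h⟩, fun h => h.2.2⟩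
  have hmemI : ∀ v, v ∈ I ↔ v ≠ u ∧ v ≠ c ∧ ¬ (linkGraph G u).Adj c v := by
    intro v
    simp only [hIdef, mem_sdiff, mem_insert, SimpleGraph.mem_neighborFinset, not_or]
    exact ⟨fun h => ⟨h.1.ne.symm, h.2⟩, fun h => ⟨hall v h.1, h.2⟩⟩
  have hdegu : (G.degree u : ℝ) = 1 + (linkGraph G u).degree c + #I := by
    have := sum_near_eq_star huc (fun _ => (1 : ℝ))
    simpa using this
  refine ⟨c, I, (linkGraph G u).degree c, ⟨hall, huc.ne, ?_, ?_, ?_⟩, hdc, ?_, ?_, ?_⟩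
  · simp [hmemI]
  · intro v hvu hvc
    rw [hlink _ _ huc.ne.symm hvu, hmemI]
    tauto
  · intro v w hvu hvc hwu hwc hvw
    rw [hlink _ _ hvu hwu] at hvw
    by_cases hv : v ∈ I
    · exact hI v hv w hvw
    · have : (linkGraph G u).Adj c v := by
        by_contra hn
        exact hv ((hmemI v).2 ⟨hvu, hvc, hn⟩)
      exact hwc (hc v this w hvw)
  · have h1 : (Fintype.card V : ℝ) = 1 + G.degree u := by
      have := sum_univ_eq_near_far (G := G) u (fun _ => (1 : ℝ))
      simpa [hfar] using this
    rw [hdegu] at h1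
    have : (Fintype.card V : ℝ) = ((linkGraph G u).degree c + #I + 2 : ℕ) := by
      push_cast; linarith
    exact_mod_cast this
  · have h1 := card_edges_eq (G := G) u
    -- At the zero vector the star weight is minus the number of link edges.
    have h2 : starWeight (linkGraph G u) 0 (G.neighborFinset u) = -(linkGraph G u).degree c := by
      rw [starWeight_sdiff _ (IsPerronVector.starAt_subset huc), starWeight_star _ hc,
        starWeight_of_edgeless _ hI]
      simp
    simp only [starWeight, Pi.zero_apply, mul_zero, zero_sub, sum_neg_distrib, ← sum_div] at h2
    rw [hfar, hdegu] at h1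
    simp only [sum_empty] at h1
    have : (#G.edgeFinset : ℝ) = (2 * (linkGraph G u).degree c + 1 + #I : ℕ) := by
      push_cast; linarith
    exact_mod_cast this
  · have hxI : ∑ v ∈ I, x v = #I * ρ⁻¹ := by
      rw [← nsmul_eq_mul, ← sum_const]
      refine sum_congr rfl fun v hv => ?_
      have h1 := h.eig v
      rw [row_sum_near (hall v ((hmemI v).1 hv).1), hfar, h.one, sum_empty,
        sum_eq_zero fun w _ => if_neg (hI v hv w)] at h1
      field_simp
      linarith
    have hs := IsPerronVector.sum_near_eq_star huc x
    rw [h.sum_near, ← hIdef, hxI] at hs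
    have hcrow := h.eig c
    rw [row_sum_near huc, hfar, h.one, sum_empty, ← sum_filter] at hcrow
    have hfil : {w ∈ G.neighborFinset u | (linkGraph G u).Adj c w} =
        (linkGraph G u).neighborFinset c := by
      ext w
      simp only [mem_filter, SimpleGraph.mem_neighborFinset]
      exact ⟨fun h => h.2, fun h => ⟨h.2.1, h⟩⟩
    rw [hfil] at hcrow
    have hm' := h.sq_sub_eq_star huc hc hI
    rw [← hIdef, hxI, hfar] at hm'
    simp only [sum_empty] at hm'
    -- Difference of the rows at u and c; each vertex of I is pendant at u and has entry 1/ρ.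
    have hxc : (ρ + 1) * (1 - x c) = #I * ρ⁻¹ := by linarith
    have hρ0 : ρ * ρ⁻¹ = 1 := mul_inv_cancel₀ (by linarith)
    linear_combination (ρ * (ρ + 1)) * hm' -
      ((linkGraph G u).degree c - 1 : ℝ) * ρ * hxc - #I * (((linkGraph G u).degree c - 1 : ℝ) + (ρ + 1)) * hρ0
end

/-! ### The extremal graphs: eigenvectors and isomorphisms -/

theorem graphSMinus_zero (n : ℕ) : graphSMinus n 0 = graphS n 2 := by
  simp [graphSMinus]

theorem graphSMinus_adj_inl_inl {n t : ℕ} (i j : Fin 2) :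
    (graphSMinus n t).Adj (Sum.inl i) (Sum.inl j) ↔ i ≠ j := by
  simp [graphSMinus, graphS, graphJoin]

theorem graphSMinus_adj_inr_inr {n t : ℕ} (i j : Fin (n - 2)) :
    ¬ (graphSMinus n t).Adj (Sum.inr i) (Sum.inr j) := by
  simp [graphSMinus, graphS, graphJoin]

theorem graphSMinus_adj_zero {n t : ℕ} (j : Fin (n - 2)) :
    (graphSMinus n t).Adj (Sum.inl 0) (Sum.inr j) ↔ ¬ (j : ℕ) < t := by
  simp [graphSMinus, graphS, graphJoin]

theorem graphSMinus_adj_one {n t : ℕ} (j : Fin (n - 2)) :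
    (graphSMinus n t).Adj (Sum.inl 1) (Sum.inr j) := by
  simp [graphSMinus, graphS, graphJoin]

theorem sum_fin_ite_lt {k t : ℕ} (h : t ≤ k) (a b : ℝ) :
    ∑ j : Fin k, (if (j : ℕ) < t then a else b) = t * a + (k - t) * b := by
  obtain ⟨d, rfl⟩ := Nat.exists_eq_add_of_le h
  rw [Fin.sum_univ_eq_sum_range (fun j => if j < t then a else b), sum_range_add,
    sum_congr rfl fun j hj => if_pos (mem_range.1 hj)]
  simp

/-- `heq` is the book equation with r = n - 2 - t. The vector has entry 1 at the full hub and is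
constant on the two classes of non-hub vertices; their rows hold by construction, and both hub rows
reduce to `heq`. -/
theorem le_graphSpectralRadius_of_iso_graphSMinus {V : Type*} [Fintype V] [DecidableEq V]
    {G : SimpleGraph V} [DecidableRel G.Adj] {n t : ℕ} (e : G ≃g graphSMinus n t)
    (ht : t ≤ n - 2) {l : ℝ} (hl : 0 < l)
    (heq : (l ^ 2 - l - (2 * ((n - 2 : ℕ) - t : ℝ) + t)) * (l * (l + 1)) =
      -(t * (l + ((n - 2 : ℕ) - t : ℝ)))) :
    l ≤ graphSpectralRadius G := by
  classical
  set k := n - 2 with hk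
  set y : Fin 2 ⊕ Fin k → ℝ := Sum.elim ![1 - t / (l * (l + 1)), 1]
    (fun j => if (j : ℕ) < t then 1 / l else (2 - t / (l * (l + 1))) / l) with hy
  have hrow : ∀ p, ∑ q, (if (graphSMinus n t).Adj p q then y q else 0) = l * y p := by
    have hl1 : l + 1 ≠ 0 := by positivity
    rintro (i | j)
    · rw [Fintype.sum_sum_type, Fin.sum_univ_two]
      simp only [graphSMinus_adj_inl_inl]
      fin_cases i
      · simp only [Fin.zero_eta, graphSMinus_adj_zero, hy, Sum.elim_inr, Sum.elim_inl]
        rw [sum_congr rfl (g := fun j : Fin k => if (j : ℕ) < t then 0 else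
          (2 - t / (l * (l + 1))) / l) fun j _ => by split_ifs <;> rfl, sum_fin_ite_lt ht]
        simp
        field_simp
        linear_combination (-1) * heq
      · simp only [Fin.mk_one, graphSMinus_adj_one, hy, Sum.elim_inr, Sum.elim_inl, if_true]
        rw [sum_fin_ite_lt ht]
        simp
        field_simp
        linear_combination (-1) * heq
    · rw [Fintype.sum_sum_type, Fin.sum_univ_two]
      simp only [graphSMinus_adj_inr_inr, (graphSMinus n t).adj_comm (Sum.inr j) (Sum.inl _),
        graphSMinus_adj_zero, graphSMinus_adj_one, hy, Sum.elim_inr, Sum.elim_inl]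
      by_cases hj : (j : ℕ) < t
      · simp [hj, hl.ne']
      · simp [hj]
        field_simp
        ring
  refine le_graphSpectralRadius_of_eigenvector G (fun v => y (e v)) ?_ fun v => ?_
  · intro h0
    have := congrFun h0 (e.symm (Sum.inl 1))
    simp [hy] at this
  · rw [← hrow (e v), ← Equiv.sum_comp e.toEquiv]
    refine sum_congr rfl fun w _ => ?_
    have : (graphSMinus n t).Adj (e v) (e w) ↔ G.Adj v w := e.map_adj_iff
    simp [this]

section
variable {V : Type*} [Fintype V] [DecidableEq V] {G : SimpleGraph V}

omit [Fintype V] in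
theorem IsBook.nonempty_iso {u c : V} {I : Finset V} (h : IsBook G u c I) {n t : ℕ}
    (g : Fin (n - 2) ≃ {v // v ≠ u ∧ v ≠ c}) (hg : ∀ j : Fin (n - 2), (j : ℕ) < t ↔ (g j).1 ∈ I) :
    Nonempty (G ≃g graphSMinus n t) := by
  -- The deficient hub c comes first, because `graphSMinus` deletes edges at `Sum.inl 0`.
  set φ : Fin 2 ⊕ Fin (n - 2) → V := Sum.elim ![c, u] fun j => (g j).1 with hφ
  have hbij : Function.Bijective φ := by
    constructor
    · rintro (i | i) (j | j) hij
      · fin_cases i <;> fin_cases j <;> simp_all [h.ne, h.ne.symm]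
      · have := (g j).2
        fin_cases i <;> simp_all
      · have := (g i).2
        fin_cases j <;> simp_all
      · exact congrArg Sum.inr (g.injective (Subtype.ext hij))
    · intro v
      by_cases hu : v = u
      · exact ⟨Sum.inl 1, hu.symm⟩
      by_cases hc : v = c
      · exact ⟨Sum.inl 0, hc.symm⟩
      exact ⟨Sum.inr (g.symm ⟨v, hu, hc⟩), by simp [hφ]⟩
  have hcr : ∀ j, G.Adj (φ (Sum.inl 0)) (φ (Sum.inr j)) ↔
      (graphSMinus n t).Adj (Sum.inl 0) (Sum.inr j) := fun j => by
    rw [graphSMinus_adj_zero, hg]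
    exact h.adj_center _ (g j).2.1 (g j).2.2
  have hur : ∀ j, G.Adj (φ (Sum.inl 1)) (φ (Sum.inr j)) ↔
      (graphSMinus n t).Adj (Sum.inl 1) (Sum.inr j) := fun j =>
    iff_of_true (h.adj_hub _ (g j).2.1) (graphSMinus_adj_one j)
  have hir : ∀ i j, G.Adj (φ (Sum.inl i)) (φ (Sum.inr j)) ↔
      (graphSMinus n t).Adj (Sum.inl i) (Sum.inr j) := fun i j => by
    fin_cases i
    exacts [hcr j, hur j]
  refine ⟨SimpleGraph.Iso.symm ⟨Equiv.ofBijective φ hbij, ?_⟩⟩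
  rintro (i | i) (j | j)
  · rw [graphSMinus_adj_inl_inl]
    have := h.adj_hub c h.ne.symm
    fin_cases i <;> fin_cases j <;> simp [hφ, this, this.symm]
  · exact hir i j
  · rw [G.adj_comm, (graphSMinus n t).adj_comm]
    exact hir j i
  · exact iff_of_false (h.indep _ _ (g i).2.1 (g i).2.2 (g j).2.1 (g j).2.2)
      (graphSMinus_adj_inr_inr i j)

theorem nonempty_fin_equiv_compl_pair {u c : V} (huc : u ≠ c) :
    Nonempty (Fin (Fintype.card V - 2) ≃ {v // v ≠ u ∧ v ≠ c}) := by
  refine ⟨(Fintype.equivFinOfCardEq ?_).symm⟩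
  rw [Fintype.card_subtype, ← card_pair huc, ← card_compl]
  congr 1
  ext v
  simp

theorem IsBook.nonempty_iso_graphS {u c : V} (h : IsBook G u c ∅) :
    Nonempty (G ≃g graphS (Fintype.card V) 2) := by
  obtain ⟨g⟩ := nonempty_fin_equiv_compl_pair h.ne
  rw [← graphSMinus_zero]
  exact h.nonempty_iso g (by simp)

theorem IsBook.nonempty_iso_graphSMinus_one {u c i : V} (h : IsBook G u c {i}) :
    Nonempty (G ≃g graphSMinus (Fintype.card V) 1) := by
  obtain ⟨g⟩ := nonempty_fin_equiv_compl_pair h.ne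
  have hi : i ≠ u ∧ i ≠ c := by
    have := h.notMem
    simp only [mem_singleton] at this
    exact ⟨Ne.symm this.1, Ne.symm this.2⟩
  set j₀ := g.symm ⟨i, hi⟩ with hj₀
  set z : Fin (Fintype.card V - 2) := ⟨0, j₀.pos⟩ with hz
  -- The swap moves i to index 0, where the edge is deleted.
  refine h.nonempty_iso ((Equiv.swap z j₀).trans g) fun j => ?_
  have h1 : (j : ℕ) < 1 ↔ j = z := by rw [Fin.ext_iff]; simp [hz]
  have h2 : ((g (Equiv.swap z j₀ j)).1 = i) ↔ Equiv.swap z j₀ j = j₀ := by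
    rw [hj₀, Equiv.eq_symm_apply, Subtype.ext_iff]
  rw [h1, mem_singleton, Equiv.trans_apply, h2, Equiv.swap_apply_eq_iff, Equiv.swap_apply_right]
end

/-! ### The quartic and the conclusion -/

/-- The quartic is thus the book equation for t = 1, where r = m/2 - 1. -/
theorem quartic_eq (m x : ℝ) : x ^ 4 - m * x ^ 2 - (m - 2) * x + (m / 2 - 1) =
    (x ^ 2 - x - (m - 1)) * (x * (x + 1)) + (x + m / 2 - 1) := by ring

theorem quartic_pos {m x : ℝ} (hm : 4 ≤ m) (hx : m ≤ x) :
    0 < x ^ 4 - m * x ^ 2 - (m - 2) * x + (m / 2 - 1) := by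
  rw [quartic_eq]
  have h1 : 0 ≤ x ^ 2 - x - (m - 1) := by nlinarith
  have h2 : 0 ≤ x * (x + 1) := by nlinarith
  have := mul_nonneg h1 h2
  linarith

theorem exists_isGreatest_quartic_root {m : ℝ} (hm : 4 ≤ m) :
    ∃ r, 1 ≤ r ∧ IsGreatest {x : ℝ | x ^ 4 - m * x ^ 2 - (m - 2) * x + (m / 2 - 1) = 0} r ∧
      ∀ x, r ≤ x → 0 ≤ x ^ 4 - m * x ^ 2 - (m - 2) * x + (m / 2 - 1) := by
  set f : ℝ → ℝ := fun x => x ^ 4 - m * x ^ 2 - (m - 2) * x + (m / 2 - 1) with hf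
  have hcont : Continuous f := by fun_prop
  have hroot : ∀ a ≤ m, f a ≤ 0 → ∃ x ∈ Set.Icc a m, f x = 0 := fun a ha h0 =>
    intermediate_value_Icc ha hcont.continuousOn ⟨h0, (quartic_pos hm le_rfl).le⟩
  have hK : IsCompact (Set.Icc 1 m ∩ {x | f x = 0}) :=
    isCompact_Icc.inter_right (isClosed_eq hcont continuous_const)
  obtain ⟨x₀, hx₀⟩ := hroot 1 (by linarith) (by simp only [hf]; linarith)
  obtain ⟨r, hr, hmax⟩ := hK.exists_isGreatest ⟨x₀, hx₀⟩
  have hub : ∀ x, f x = 0 → x ≤ r := by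
    intro x hx
    rcases le_total x 1 with h1 | h1
    · exact h1.trans hr.1.1
    rcases le_or_gt m x with h2 | h2
    · exact absurd hx (quartic_pos hm h2).ne'
    · exact hmax ⟨⟨h1, h2.le⟩, hx⟩
  refine ⟨r, hr.1.1, ⟨hr.2, fun x hx => hub x hx⟩, fun x hx => ?_⟩
  by_contra! hneg
  have hxm : x ≤ m := by
    by_contra! h
    exact absurd hneg (quartic_pos hm h.le).not_gt
  obtain ⟨y, hy, hy0⟩ := hroot x hxm hneg.le
  have hyx : y = x := le_antisymm ((hub y hy0).trans hx) hy.1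
  exact hneg.ne (hyx ▸ hy0)

theorem exists_isBook_of_lt {V : Type*} [Fintype V] [DecidableEq V] {G : SimpleGraph V}
    [DecidableRel G.Adj] {m : ℕ} (hgem : gem.Free G) (hsize : #G.edgeFinset = m) (hm : 92 ≤ m)
    (hiso : ∀ v : V, ¬ G.IsIsolated v) {ρ : ℝ} (hρ : ρ = graphSpectralRadius G)
    (hlt : (m : ℝ) - 3 / 2 < ρ ^ 2 - ρ) :
    ∃ (u c : V) (I : Finset V) (r : ℕ), IsBook G u c I ∧ 1 ≤ r ∧ 10 ≤ ρ ∧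
      Fintype.card V = r + #I + 2 ∧ m = 2 * r + 1 + #I ∧
      (ρ ^ 2 - ρ - ((m : ℝ) - 1)) * (ρ * (ρ + 1)) = -(#I * (ρ + r)) := by
  have hne : Nonempty V := by
    by_contra h
    rw [not_nonempty_iff] at h
    rw [eq_empty_of_isEmpty G.edgeFinset, card_empty] at hsize
    omega
  obtain ⟨x, u, h1, h0, hle, heig⟩ := exists_normalized_eigenvector G
  have hρ0 : 0 ≤ ρ := hρ ▸ ENNReal.toReal_nonneg
  have hm' : (92 : ℝ) ≤ m := by exact_mod_cast hm
  -- Here m ≥ 92 enters: ρ² - ρ > 90.5, while 10² - 10 = 90.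
  have hρ10 : 10 ≤ ρ := by nlinarith
  have hiso' : ∀ v, ∃ w, G.Adj v w := fun v => by
    by_contra! h
    exact hiso v fun w hw => h w hw
  have hP : IsPerronVector G ρ x u := ⟨h1, h0, hle, hρ ▸ heig⟩
  subst hsize
  obtain ⟨c, I, r, h⟩ := hP.exists_isBook hgem hρ10 hlt hiso'
  exact ⟨u, c, I, r, h.1, h.2.1, hρ10, h.2.2⟩

theorem theorem1p5 {V : Type*} [Fintype V] [DecidableEq V]
    (G : SimpleGraph V) [DecidableRel G.Adj] (m : ℕ)
    (hgem : gem.Free G)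
    (hsize : G.edgeFinset.card = m) (hm : 92 ≤ m)
    (hiso : ∀ v : V, ¬ G.IsIsolated v) :
    (Odd m →
      graphSpectralRadius G ≤ (1 + √(4 * (m : ℝ) - 3)) / 2 ∧
      (graphSpectralRadius G = (1 + √(4 * (m : ℝ) - 3)) / 2 ↔
        Nonempty (G ≃g graphS ((m + 3) / 2) 2))) ∧
    (Even m →
      ∃ r : ℝ,
        IsGreatest {x : ℝ | x ^ 4 - (m : ℝ) * x ^ 2 - ((m : ℝ) - 2) * x
          + ((m : ℝ) / 2 - 1) = 0} r ∧
        graphSpectralRadius G ≤ r ∧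
        (graphSpectralRadius G = r ↔
          Nonempty (G ≃g graphSMinus ((m + 4) / 2) 1))) := by
  have hm' : (92 : ℝ) ≤ m := by exact_mod_cast hm
  obtain ⟨ρ, hρ⟩ : ∃ ρ, ρ = graphSpectralRadius G := ⟨_, rfl⟩
  rw [← hρ]
  constructor
  · intro hodd
    set v := (1 + √(4 * (m : ℝ) - 3)) / 2 with hv
    have hv0 : 1 / 2 ≤ v := by
      have := Real.sqrt_nonneg (4 * (m : ℝ) - 3)
      linarith
    have hvv : v ^ 2 - v = m - 1 := by
      have := Real.sq_sqrt (show 0 ≤ 4 * (m : ℝ) - 3 by linarith)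
      rw [hv]
      linear_combination this / 4
    -- This implication yields the bound and the forward equality case; for the converse it remains
    -- to show v ≤ ρ.
    have key : v ≤ ρ → ρ = v ∧ Nonempty (G ≃g graphS ((m + 3) / 2) 2) := by
      intro hle
      have hge : (m : ℝ) - 1 ≤ ρ ^ 2 - ρ := by nlinarith
      obtain ⟨u, c, I, r, hB, hr, hρ10, hcard, hmr, heq⟩ :=
        exists_isBook_of_lt hgem hsize hm hiso hρ (by linarith)
      have hr0 : (0 : ℝ) ≤ r := Nat.cast_nonneg r
      have hI0 : (#I : ℝ) = 0 := by
        have h1 : 0 ≤ (ρ ^ 2 - ρ - ((m : ℝ) - 1)) * (ρ * (ρ + 1)) :=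
          mul_nonneg (by linarith) (by positivity)
        have h2 : (0 : ℝ) ≤ #I := Nat.cast_nonneg _
        nlinarith
      have hI : I = ∅ := by simpa using hI0
      subst hI
      constructor
      · rw [hI0, zero_mul, neg_zero, mul_eq_zero, or_iff_left (by positivity)] at heq
        have : (ρ - v) * (ρ + v - 1) = 0 := by linear_combination heq - hvv
        rcases mul_eq_zero.1 this with h | h <;> linarith
      · have hn : (m + 3) / 2 = Fintype.card V := by simp at hmr hcard; omega
        rw [hn]
        exact hB.nonempty_iso_graphS
    refine ⟨?_, fun h => (key h.ge).2, ?_⟩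
    · by_contra! h
      exact h.ne' (key h.le).1
    · rintro ⟨e⟩
      refine (key ?_).1
      rw [← graphSMinus_zero] at e
      rw [hρ]
      refine le_graphSpectralRadius_of_iso_graphSMinus e (Nat.zero_le _) (by linarith) ?_
      obtain ⟨k, hk⟩ := hodd
      have hn : (m + 3) / 2 - 2 = k := by omega
      have hmk : (m : ℝ) = 2 * k + 1 := by exact_mod_cast hk
      rw [hn]
      push_cast
      linear_combination (v * (v + 1)) * (hvv + hmk)
  · intro heven
    obtain ⟨v, hv1, hv, hpos⟩ := exists_isGreatest_quartic_root (m := (m : ℝ)) (by linarith)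
    refine ⟨v, hv, ?_⟩
    have key : v ≤ ρ → ρ = v ∧ Nonempty (G ≃g graphSMinus ((m + 4) / 2) 1) := by
      intro hle
      have hf := hpos ρ hle
      have hlt : (m : ℝ) - 3 / 2 < ρ ^ 2 - ρ := by
        have hf' := hf
        rw [quartic_eq] at hf'
        by_contra! hcon
        -- Twice the quartic at ρ equals this product minus 1/2.
        have h1 : (ρ ^ 2 - ρ - ((m : ℝ) - 1) + 1 / 2) * (2 * ρ ^ 2 + 2 * ρ - 1) ≤ 0 :=
          mul_nonpos_of_nonpos_of_nonneg (by linarith) (by nlinarith)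
        linarith
      obtain ⟨u, c, I, r, hB, hr, hρ10, hcard, hmr, heq⟩ :=
        exists_isBook_of_lt hgem hsize hm hiso hρ hlt
      have hmR : (m : ℝ) = 2 * r + 1 + #I := by exact_mod_cast hmr
      have hr1 : (1 : ℝ) ≤ r := by exact_mod_cast hr
      have ht1 : 1 ≤ #I := by
        obtain ⟨k, hk⟩ := heven
        omega
      have ht1R : (1 : ℝ) ≤ #I := by exact_mod_cast ht1
      rw [quartic_eq, heq] at hf
      -- With t = #I, the quartic at ρ is now (1 - t)(ρ + r - 1/2), and it is nonnegative.
      have hI1R : (#I : ℝ) = 1 := by nlinarith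
      have hI1 : #I = 1 := by exact_mod_cast hI1R
      constructor
      · refine le_antisymm (hv.2 ?_) hle
        rw [Set.mem_ofPred_eq, quartic_eq, heq, hI1R]
        linarith
      · obtain ⟨i, rfl⟩ := card_eq_one.1 hI1
        have hn : (m + 4) / 2 = Fintype.card V := by omega
        rw [hn]
        exact hB.nonempty_iso_graphSMinus_one
    refine ⟨?_, fun h => (key h.ge).2, ?_⟩
    · by_contra! h
      exact h.ne' (key h.le).1
    · rintro ⟨e⟩
      refine (key ?_).1
      rw [hρ]
      refine le_graphSpectralRadius_of_iso_graphSMinus e (by omega) (by linarith) ?_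
      obtain ⟨k, hk⟩ := heven
      have hn : (m + 4) / 2 - 2 = k := by omega
      have hmk : (m : ℝ) = k + k := by exact_mod_cast hk
      have hv0 := hv.1
      rw [Set.mem_ofPred_eq, quartic_eq] at hv0
      rw [hn]
      push_cast
      rw [hmk] at hv0
      linear_combination hv0
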